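/- Let $F=\mathbb{F}_q$ be a finite field with $q$ elements, and let $0<\varepsilon<1$ and $0<R<1$ be fixed. For a linear code $C\subseteq\mathbb{F}_q^n$ let $P_{\mathrm{ud}}(C,\varepsilon)$ be the probability that unambiguous decoding is unsuccessful over the $q$-ary erasure channel: a uniformly random codeword of $C$ is sent, each symbol is erased independently with probability $\varepsilon$, and decoding is unsuccessful if the unerased symbols do not determine a unique codeword of $C$. (Equivalently, $P_{\mathrm{ud}}(C,\varepsilon)=\sum_{i=1}^n I_i(C)\varepsilon^i(1-\varepsilon)^{n-i}$, where $I_i(C)$ is the number of $i$-element sets $E\subseteq\{1,\dots,n\}$ such that $C$ contains a nonzero codeword vanishing outside $E$.) Let $\mathcal{R}_{m,n}$ be the set of all $m\times n$ matrices over $\mathbb{F}_q$ with the uniform distribution. For $H\in\mathcal{R}_{m,n}$ put $P_{\mathrm{ud}}(H,\varepsilon)=P_{\mathrm{ud}}(C_H,\varepsilon)$, where $C_H=\{\mathbf{x}\in\mathbb{F}_q^n: H\mathbf{x}^t=\mathbf{0}\}$, and let $P_{\mathrm{ud}}(\mathcal{R}_{m,n},\varepsilon)=\mathbb{E}[P_{\mathrm{ud}}(H,\varepsilon)]$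 be the average over $\mathcal{R}_{m,n}$. Assume that either 1. $\dfrac{1-\varepsilon}{1+(q-1)\varepsilon^2}\le R<1-\varepsilon$ (with any $q$), or 2. $\dfrac{1-\varepsilon}{1+(q-1)\varepsilon}\le R<1-\varepsilon$ and $q\in\{2,3,4\}$. Then, as $n\to\infty$ and $H_n$ runs over $\mathcal{R}_{m,n}$ with $m=(1-R)n$ (rounded up or down to an integer where necessary), $P_{\mathrm{ud}}(H_n,\varepsilon)/P_{\mathrm{ud}}(\mathcal{R}_{m,n},\varepsilon)\to1$ with high probability. That is, for every $\delta>0$ there are $c>0$ and $n_0>0$ such that for all $n>n_0$ and all integers $m\geq 0$ with $|m-(1-R)n|<1$, $$\mathbb{P}\left(\left|\frac{P_{\mathrm{ud}}(H_n,\varepsilon)}{P_{\mathrm{ud}}(\mathcal{R}_{m,n},\varepsilon)}-1\right|<\delta\right)>1-q^{-nc}.$$ -/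

import Mathlib

/-- The word received when `c` is sent over the erasure channel and exactly the positions in `E`
are erased (an erased position carries `none`). -/
def received {F : Type*} {n : ℕ} (c : Fin n → F) (E : Finset (Fin n)) : Fin n → Option F :=
  fun i => if i ∈ E then none else some (c i)

/-- The codewords of `C` that agree with the received word `y` at every unerased position. -/
def candidates {F : Type*} [Field F] {n : ℕ} (C : Submodule F (Fin n → F))
    (y : Fin n → Option F) : Set (Fin n → F) :=
  {c | c ∈ C ∧ ∀ i a, y i = some a → c i = a}

open Classical in
/-- `P_ud(C, ε)`: the probability that unambiguous decoding of the linear code `C` is unsuccessful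
over the erasure channel with erasure probability `ε`. A codeword `c` is sent, uniformly at random,
every position is erased independently with probability `ε` (so `E` is the set of erased positions
with probability `ε ^ #E * (1 - ε) ^ (n - #E)`), and decoding is unsuccessful when the received
word does not determine a unique codeword. -/
noncomputable def pUd {F : Type*} [Field F] [Fintype F] {n : ℕ} (C : Submodule F (Fin n → F))
    (ε : ℝ) : ℝ :=
  (∑ c ∈ Finset.univ.filter (fun c : Fin n → F => c ∈ C),
      ∑ E : Finset (Fin n), ε ^ E.card * (1 - ε) ^ (n - E.card) *
        (if ∃! c', c' ∈ candidates C (received c E) then 0 else 1)) /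
    ((Finset.univ.filter (fun c : Fin n → F => c ∈ C)).card : ℝ)

/-- The parity-check code `C_H = {x | H xᵗ = 0}`. -/
def parityCheckCode {F : Type*} [Field F] {m n : ℕ} (H : Matrix (Fin m) (Fin n) F) :
    Submodule F (Fin n → F) :=
  LinearMap.ker H.mulVecLin

/-- The expectation `𝔼[X]` of a function `X` of a uniformly distributed `m × n` matrix over `F`. -/
noncomputable def ensembleMean {F : Type*} [Fintype F] {m n : ℕ}
    (X : Matrix (Fin m) (Fin n) F → ℝ) : ℝ :=
  (∑ H : Matrix (Fin m) (Fin n) F, X H) / (Fintype.card (Matrix (Fin m) (Fin n) F) : ℝ)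

open Classical in
/-- The probability that a uniformly distributed `m × n` matrix over `F` satisfies `A`. -/
noncomputable def ensembleProb {F : Type*} [Fintype F] {m n : ℕ}
    (A : Matrix (Fin m) (Fin n) F → Prop) : ℝ :=
  ((Finset.univ.filter A).card : ℝ) / (Fintype.card (Matrix (Fin m) (Fin n) F) : ℝ)

/-- `P_ud(H, ε) = P_ud(C_H, ε)`. -/
noncomputable def pUdMatrix {F : Type*} [Field F] [Fintype F] {m n : ℕ}
    (H : Matrix (Fin m) (Fin n) F) (ε : ℝ) : ℝ :=
  pUd (parityCheckCode H) ε

/-- `P_ud(R_{m,n}, ε)`: the mean of `P_ud(H, ε)` over the random matrix ensemble `R_{m,n}`. -/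
noncomputable def pUdEnsemble (F : Type*) [Field F] [Fintype F] (m n : ℕ) (ε : ℝ) : ℝ :=
  ensembleMean (fun H : Matrix (Fin m) (Fin n) F => pUdMatrix H ε)

/-! The proof is a second-moment argument. Decoding fails on an erasure set `E` exactly when the
columns of `H` indexed by `E` are linearly dependent, so `P_ud` is a weighted sum of indicators over
`E`. By Chebyshev it suffices that the variance over the squared mean decays exponentially.

Variance: given that the columns in `E ∩ E'` are independent, independence on `E` and on `E'` are
independent events (`sum_recoverable_and`). Hence the covariance is `P(E and E' recoverable) * (1 -
P(E ∩ E' recoverable))`, at most `q ^ (#(E ∩ E') - m)`, and it is zero once `E` or `E'` has more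
than `m` elements. A Chernoff tilt `t ≤ 1` exploits this size restriction, and the sum over pairs
factors over the positions (`variance_le`).

Mean: `m + 1` erasures always defeat decoding. With `v = (1 - R) / R`, the term of index `m + 1` in
the expansion of `(1 + v) ^ n` is within a factor `4 (n + 1)` of the whole, which makes this lower
bound explicit (`one_add_pow_le`).

With `u = t ε / (1 - ε)`, the ratio has exponential rate `(v² / (q u²)) ^ (1 - R) * (1 + 2u + q u²)
/ (1 + v)²`. The hypotheses on `R` say exactly that a suitable `u` respects `t ≤ 1`; `exists_tilt`
shows that the rate is then below `1`. -/

/-- Every codeword of the parity-check code of `H` is determined by its symbols outside `E`. -/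
def Recoverable {F : Type*} [Field F] {m n : ℕ} (H : Matrix (Fin m) (Fin n) F)
    (E : Finset (Fin n)) : Prop :=
  ∀ x : Fin n → F, H.mulVec x = 0 → (∀ i, i ∉ E → x i = 0) → x = 0

/-! ### Counting matrices with independent columns -/

section Counting

variable {F : Type*} [Field F] {m n : ℕ}

theorem Recoverable.mono {H : Matrix (Fin m) (Fin n) F} {S E : Finset (Fin n)}
    (h : Recoverable H E) (hSE : S ⊆ E) : Recoverable H S :=
  fun x hx hS => h x hx fun i hi => hS i fun hi' => hi (hSE hi')

theorem existsUnique_candidates_iff (H : Matrix (Fin m) (Fin n) F) (E : Finset (Fin n))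
    {c : Fin n → F} (hc : c ∈ parityCheckCode H) :
    (∃! c', c' ∈ candidates (parityCheckCode H) (received c E)) ↔ Recoverable H E := by
  have hmem : ∀ x : Fin n → F, x ∈ parityCheckCode H ↔ H.mulVec x = 0 := fun x => by
    simp [parityCheckCode]
  have hcand : ∀ c', c' ∈ candidates (parityCheckCode H) (received c E) ↔
      c' ∈ parityCheckCode H ∧ ∀ i, i ∉ E → c' i = c i := by
    intro c'
    refine and_congr_right fun _ => forall_congr' fun i => ?_
    by_cases hi : i ∈ E <;> simp [received, hi]
  simp only [hcand]
  constructor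
  · rintro ⟨d, -, hd⟩ x hx hxE
    have h1 := hd c ⟨hc, fun _ _ => rfl⟩
    have h2 := hd (c + x) ⟨Submodule.add_mem _ hc ((hmem x).2 hx), fun i hi => by simp [hxE i hi]⟩
    have h3 : c + x = c := h2.trans h1.symm
    simpa using h3
  · intro h
    refine ⟨c, ⟨hc, fun _ _ => rfl⟩, ?_⟩
    rintro d ⟨hd, hdE⟩
    exact sub_eq_zero.1 (h (d - c) ((hmem _).1 (Submodule.sub_mem _ hd hc))
      fun i hi => by simp [hdE i hi])

theorem not_recoverable_of_card_lt (H : Matrix (Fin m) (Fin n) F) {E : Finset (Fin n)}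
    (hE : m < E.card) : ¬ Recoverable H E := by
  intro h
  let φ : (E → F) →ₗ[F] (Fin n → F) :=
    { toFun := fun y i => if hi : i ∈ E then y ⟨i, hi⟩ else 0
      map_add' := fun x y => by ext i; by_cases hi : i ∈ E <;> simp [hi]
      map_smul' := fun a y => by ext i; by_cases hi : i ∈ E <;> simp [hi] }
  have hφ : ∀ y i, φ y i = if hi : i ∈ E then y ⟨i, hi⟩ else 0 := fun _ _ => rfl
  have hinj : Function.Injective (H.mulVecLin.comp φ) := by
    refine (injective_iff_map_eq_zero _).2 fun y hy => ?_
    have h0 := h (φ y) (by simpa using hy) fun i hi => by simp [hφ, hi]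
    ext ⟨i, hi⟩
    have := congrFun h0 i
    simpa [hφ, hi] using this
  have := LinearMap.finrank_le_finrank_of_injective hinj
  simp at this
  omega

/-- The matrix `H` with the vector `c` added to its column `k`. -/
def addCol (H : Matrix (Fin m) (Fin n) F) (k : Fin n) (c : Fin m → F) :
    Matrix (Fin m) (Fin n) F :=
  H + Matrix.vecMulVec c (Pi.single k 1)

theorem addCol_mulVec (H : Matrix (Fin m) (Fin n) F) (k : Fin n) (c : Fin m → F)
    (x : Fin n → F) : (addCol H k c).mulVec x = H.mulVec x + x k • c := by
  rw [addCol, Matrix.add_mulVec, Matrix.vecMulVec_mulVec]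
  simp

theorem recoverable_addCol_iff (H : Matrix (Fin m) (Fin n) F) {k : Fin n} (c : Fin m → F)
    {T : Finset (Fin n)} (hk : k ∉ T) : Recoverable (addCol H k c) T ↔ Recoverable H T := by
  refine forall_congr' fun x => ?_
  rw [addCol_mulVec]
  constructor <;> intro h h1 h2 <;> refine h ?_ h2 <;> simpa [h2 k hk] using h1

variable [Fintype F]

/-- Translation by a fixed matrix permutes all matrices, so column `k` may be rerandomized without
changing averages. -/
theorem sum_addCol (f : Matrix (Fin m) (Fin n) F → ℝ) (k : Fin n) :
    ∑ H, ∑ c : Fin m → F, f (addCol H k c) = (Fintype.card F : ℝ) ^ m * ∑ H, f H := by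
  rw [Finset.sum_comm]
  have : ∀ c : Fin m → F, ∑ H, f (addCol H k c) = ∑ H, f H := fun c =>
    Fintype.sum_equiv (Equiv.addRight (Matrix.vecMulVec c (Pi.single k 1))) _ _ fun _ => rfl
  simp [this]

open Classical in
/-- The vectors that vanish outside `T`. -/
noncomputable def supportedVectors (F : Type*) [Field F] [Fintype F] {n : ℕ}
    (T : Finset (Fin n)) : Finset (Fin n → F) :=
  Fintype.piFinset fun i => if i ∈ T then Finset.univ else {0}

theorem mem_supportedVectors {T : Finset (Fin n)} {x : Fin n → F} :
    x ∈ supportedVectors F T ↔ ∀ i, i ∉ T → x i = 0 := by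
  rw [supportedVectors, Fintype.mem_piFinset]
  refine forall_congr' fun i => ?_
  by_cases hi : i ∈ T <;> simp [hi]

theorem card_supportedVectors (T : Finset (Fin n)) :
    (supportedVectors F T).card = Fintype.card F ^ T.card := by
  rw [supportedVectors, Fintype.card_piFinset]
  have : ∀ i, (if i ∈ T then (Finset.univ : Finset F) else {0}).card
      = if i ∈ T then Fintype.card F else 1 := fun i => by split_ifs <;> simp
  simp [this]

open Classical in
theorem sum_recoverable_insert {H : Matrix (Fin m) (Fin n) F} {k : Fin n} {T : Finset (Fin n)}
    (hk : k ∉ T) (hT : Recoverable H T) :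
    ∑ c : Fin m → F, (if Recoverable (addCol H k c) (insert k T) then (1 : ℝ) else 0)
      = (Fintype.card F : ℝ) ^ m - (Fintype.card F : ℝ) ^ T.card := by
  -- The bad `c` are those moving column `k` into the span of the columns in `T`; this span has `q ^
  -- #T` elements because those columns are independent.
  have key : Finset.univ.filter (fun c => ¬ Recoverable (addCol H k c) (insert k T))
      = (supportedVectors F T).image (fun x => H.mulVec x - H.mulVec (Pi.single k 1)) := by
    ext c
    simp only [Finset.mem_filter, Finset.mem_univ, true_and, Finset.mem_image,
      mem_supportedVectors]
    constructor
    · intro h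
      simp only [Recoverable, not_forall] at h
      obtain ⟨y, hy, hys, hy0⟩ := h
      rw [addCol_mulVec] at hy
      have hyk : y k ≠ 0 := by
        intro h0
        refine hy0 (hT y (by simpa [h0] using hy) fun i hi => ?_)
        by_cases hik : i = k
        · rw [hik, h0]
        · exact hys i (by simp [hik, hi])
      refine ⟨Pi.single k 1 - (y k)⁻¹ • y, fun i hi => ?_, ?_⟩
      · by_cases hik : i = k
        · subst hik; simp [hyk]
        · simp [hik, hys i (by simp [hik, hi])]
      · rw [Matrix.mulVec_sub, Matrix.mulVec_smul, eq_neg_of_add_eq_zero_left hy]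
        simp [smul_smul, hyk]
    · rintro ⟨x, hx, rfl⟩ h
      have h1 := h (Pi.single k 1 - x) (by
        rw [addCol_mulVec, Matrix.mulVec_sub]; simp [hx k hk]) (fun i hi => by
          simp only [Finset.mem_insert, not_or] at hi
          simp [hi.1, hx i hi.2])
      have := congrFun h1 k
      simp [hx k hk] at this
  have hcard : (Finset.univ.filter (fun c => ¬ Recoverable (addCol H k c) (insert k T))).card
      = Fintype.card F ^ T.card := by
    rw [key, Finset.card_image_of_injOn, card_supportedVectors]
    intro x hx y hy hxy
    have hx' := mem_supportedVectors.1 (Finset.mem_coe.1 hx)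
    have hy' := mem_supportedVectors.1 (Finset.mem_coe.1 hy)
    refine sub_eq_zero.1 (hT (x - y) ?_ fun i hi => by simp [hx' i hi, hy' i hi])
    rw [Matrix.mulVec_sub, sub_eq_zero]
    simpa using hxy
  have htot := Finset.card_filter_add_card_filter_not (s := (Finset.univ : Finset (Fin m → F)))
    (fun c => Recoverable (addCol H k c) (insert k T))
  rw [hcard] at htot
  rw [Finset.sum_boole, eq_sub_iff_add_eq]
  have h2 : (Finset.univ : Finset (Fin m → F)).card = Fintype.card F ^ m := by simp
  rw [h2] at htot
  exact_mod_cast htot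

open Classical in
-- The columns in `D` are fresh given `A`. Exposed one at a time, each must avoid the span of the
-- independent columns already present. The resulting factor depends on `A` only through `#S`, which
-- is what yields conditional independence.
theorem sum_recoverable_union (A : Matrix (Fin m) (Fin n) F → Prop) {S : Finset (Fin n)}
    (hA : ∀ H, A H → Recoverable H S) (D : Finset (Fin n)) (hSD : Disjoint S D)
    (hD : ∀ k ∈ D, ∀ c H, A (addCol H k c) ↔ A H) :
    ((Fintype.card F : ℝ) ^ m) ^ D.card *
        ∑ H, (if A H ∧ Recoverable H (S ∪ D) then (1 : ℝ) else 0)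
      = (∏ j ∈ Finset.range D.card,
          ((Fintype.card F : ℝ) ^ m - (Fintype.card F : ℝ) ^ (S.card + j))) *
        ∑ H, (if A H then (1 : ℝ) else 0) := by
  induction D using Finset.induction_on with
  | empty =>
    have : ∀ H, (A H ∧ Recoverable H (S ∪ ∅)) ↔ A H := fun H => by
      simpa using hA H
    simp only [this]
    simp
  | insert k D hk ih =>
    have hSD' : Disjoint S D := hSD.mono_right (Finset.subset_insert _ _)
    have ih := ih hSD' fun j hj => hD j (Finset.mem_insert_of_mem hj)
    have hkS : k ∉ S := fun h => Finset.disjoint_left.1 hSD h (Finset.mem_insert_self _ _)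
    have hkT : k ∉ S ∪ D := by simp [hk, hkS]
    have step : (Fintype.card F : ℝ) ^ m *
        ∑ H, (if A H ∧ Recoverable H (S ∪ insert k D) then (1 : ℝ) else 0)
        = ((Fintype.card F : ℝ) ^ m - (Fintype.card F : ℝ) ^ (S.card + D.card)) *
          ∑ H, (if A H ∧ Recoverable H (S ∪ D) then (1 : ℝ) else 0) := by
      rw [← sum_addCol _ k, Finset.mul_sum, Finset.union_insert]
      refine Finset.sum_congr rfl fun H _ => ?_
      simp only [hD k (Finset.mem_insert_self _ _)]
      by_cases hAH : A H
      · by_cases hT : Recoverable H (S ∪ D)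
        · simp only [hAH, hT, true_and, if_true, mul_one]
          rw [sum_recoverable_insert hkT hT, Finset.card_union_of_disjoint hSD']
        · have : ∀ c, ¬ Recoverable (addCol H k c) (insert k (S ∪ D)) := fun c hc =>
            hT ((recoverable_addCol_iff H c hkT).1 (hc.mono (Finset.subset_insert _ _)))
          simp [hT, this]
      · simp [hAH]
    rw [Finset.card_insert_of_notMem hk, pow_succ, mul_assoc, step, Finset.prod_range_succ,
      mul_left_comm, ih]
    ring

open Classical in
theorem sum_recoverable_and (E E' : Finset (Fin n)) :
    (∑ H : Matrix (Fin m) (Fin n) F, (if Recoverable H (E ∩ E') then (1 : ℝ) else 0)) *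
      ∑ H : Matrix (Fin m) (Fin n) F, (if Recoverable H E ∧ Recoverable H E' then (1 : ℝ) else 0)
    = (∑ H : Matrix (Fin m) (Fin n) F, (if Recoverable H E then (1 : ℝ) else 0)) *
      ∑ H : Matrix (Fin m) (Fin n) F, (if Recoverable H E' then (1 : ℝ) else 0) := by
  have hdisj : Disjoint (E ∩ E') (E \ E') := by
    rw [Finset.disjoint_left]; simp +contextual
  have hun : E ∩ E' ∪ E \ E' = E := by rw [Finset.union_comm, Finset.sdiff_union_inter]
  have hS := sum_recoverable_union (fun H : Matrix (Fin m) (Fin n) F => Recoverable H (E ∩ E'))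
    (fun _ h => h) (E \ E') hdisj fun k hk c H => recoverable_addCol_iff H c (by
      simp at hk; simp [hk.2])
  -- The same columns `E \ E'` are added to the same `S`, now under the stronger event, so the
  -- product of factors is identical and cancels.
  have hE' := sum_recoverable_union (fun H : Matrix (Fin m) (Fin n) F => Recoverable H E')
    (S := E ∩ E') (fun _ h => h.mono Finset.inter_subset_right) (E \ E') hdisj
    fun k hk c H => recoverable_addCol_iff H c (by simp at hk; simp [hk.2])
  rw [hun] at hS hE'
  have h1 : ∀ H : Matrix (Fin m) (Fin n) F,
      (Recoverable H (E ∩ E') ∧ Recoverable H E) ↔ Recoverable H E := fun H =>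
    and_iff_right_of_imp fun h => h.mono Finset.inter_subset_left
  simp only [h1] at hS
  simp only [and_comm (b := Recoverable _ E)] at hE'
  have hq : ((Fintype.card F : ℝ) ^ m) ^ (E \ E').card ≠ 0 := by
    have : (Fintype.card F : ℝ) ≠ 0 := by exact_mod_cast Fintype.card_ne_zero
    positivity
  refine mul_left_cancel₀ hq ?_
  rw [mul_left_comm, hE', ← mul_assoc _ (∑ H : Matrix (Fin m) (Fin n) F, _), hS]
  ring

open Classical in
theorem sum_mulVec_eq_zero {x : Fin n → F} (hx : x ≠ 0) :
    (Fintype.card F : ℝ) ^ m *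
        ∑ H : Matrix (Fin m) (Fin n) F, (if H.mulVec x = 0 then (1 : ℝ) else 0)
      = Fintype.card (Matrix (Fin m) (Fin n) F) := by
  obtain ⟨k, hk⟩ := Function.ne_iff.1 hx
  simp only [Pi.zero_apply] at hk
  rw [← sum_addCol _ k]
  have : ∀ H : Matrix (Fin m) (Fin n) F,
      ∑ c : Fin m → F, (if (addCol H k c).mulVec x = 0 then (1 : ℝ) else 0) = 1 := by
    intro H
    have : ∀ c, (addCol H k c).mulVec x = 0 ↔ c = -((x k)⁻¹ • H.mulVec x) := by
      intro c
      rw [addCol_mulVec, add_comm, add_eq_zero_iff_eq_neg]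
      constructor
      · intro h
        rw [← smul_neg, ← h, smul_smul, inv_mul_cancel₀ hk, one_smul]
      · intro h
        rw [h, smul_neg, smul_smul, mul_inv_cancel₀ hk, one_smul]
    simp [this]
  simp [this]

open Classical in
-- Union bound over the vectors supported on `S`: each nonzero one lies in the kernel with
-- probability `q ^ (-m)`.
theorem sum_not_recoverable_le (S : Finset (Fin n)) :
    (Fintype.card F : ℝ) ^ m *
        ∑ H : Matrix (Fin m) (Fin n) F, (if Recoverable H S then (0 : ℝ) else 1)
      ≤ (Fintype.card F : ℝ) ^ S.card * Fintype.card (Matrix (Fin m) (Fin n) F) := by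
  have hle : ∀ H : Matrix (Fin m) (Fin n) F, (if Recoverable H S then (0 : ℝ) else 1)
      ≤ ∑ x ∈ (supportedVectors F S).filter (· ≠ 0), if H.mulVec x = 0 then (1 : ℝ) else 0 := by
    intro H
    split_ifs with h
    · exact Finset.sum_nonneg fun x _ => by split_ifs <;> norm_num
    · simp only [Recoverable, not_forall] at h
      obtain ⟨x, hx, hxS, hx0⟩ := h
      refine le_trans ?_ (Finset.single_le_sum (fun x _ => by split_ifs <;> norm_num)
        (Finset.mem_filter.2 ⟨mem_supportedVectors.2 hxS, hx0⟩))
      simp [hx]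
  calc _ ≤ (Fintype.card F : ℝ) ^ m * ∑ H : Matrix (Fin m) (Fin n) F,
        ∑ x ∈ (supportedVectors F S).filter (· ≠ 0), if H.mulVec x = 0 then (1 : ℝ) else 0 := by
        gcongr with H; exact hle H
    _ = ∑ x ∈ (supportedVectors F S).filter (· ≠ 0),
        (Fintype.card (Matrix (Fin m) (Fin n) F) : ℝ) := by
        rw [Finset.sum_comm, Finset.mul_sum]
        exact Finset.sum_congr rfl fun x hx => sum_mulVec_eq_zero (Finset.mem_filter.1 hx).2
    _ ≤ _ := by
        rw [Finset.sum_const, nsmul_eq_mul]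
        gcongr
        rw [← Nat.cast_pow, ← card_supportedVectors S]
        exact_mod_cast Finset.card_filter_le _ _

end Counting


/-! ### Means and probabilities over the ensemble -/

section Ensemble

variable {F : Type*} [Fintype F] {m n : ℕ}

theorem ensembleMean_sum {ι : Type*} (s : Finset ι) (X : ι → Matrix (Fin m) (Fin n) F → ℝ) :
    ensembleMean (fun H => ∑ i ∈ s, X i H) = ∑ i ∈ s, ensembleMean (X i) := by
  simp only [ensembleMean]
  rw [Finset.sum_comm, Finset.sum_div]

theorem ensembleMean_const_mul (a : ℝ) (X : Matrix (Fin m) (Fin n) F → ℝ) :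
    ensembleMean (fun H => a * X H) = a * ensembleMean X := by
  simp only [ensembleMean]
  rw [← Finset.mul_sum, mul_div_assoc]

theorem ensembleProb_eq_mean (A : Matrix (Fin m) (Fin n) F → Prop) [DecidablePred A] :
    ensembleProb A = ensembleMean fun H => if A H then 1 else 0 := by
  rw [ensembleProb, ensembleMean, Finset.sum_boole]
  congr!

theorem ensembleProb_eq_zero {A : Matrix (Fin m) (Fin n) F → Prop} (h : ∀ H, ¬ A H) :
    ensembleProb A = 0 := by
  classical
  simp [ensembleProb, h]

end Ensemble

/-! ### Variance, mean and Chebyshev's inequality -/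

section Variance

variable {F : Type*} [Field F] [Fintype F] {m n : ℕ}

open Classical in
-- By linearity, failure depends on the erasure set alone, so the average over codewords is trivial.
theorem pUdMatrix_eq (H : Matrix (Fin m) (Fin n) F) (ε : ℝ) :
    pUdMatrix H ε = ∑ E : Finset (Fin n), ε ^ E.card * (1 - ε) ^ (n - E.card) *
      (if Recoverable H E then 0 else 1) := by
  rw [pUdMatrix, pUd, div_eq_iff, Finset.sum_congr rfl (g := fun _ => ∑ E : Finset (Fin n),
    ε ^ E.card * (1 - ε) ^ (n - E.card) * (if Recoverable H E then 0 else 1))]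
  · rw [Finset.sum_const, nsmul_eq_mul, mul_comm]
  · intro c hc
    refine Finset.sum_congr rfl fun E _ => ?_
    simp only [existsUnique_candidates_iff H E (Finset.mem_filter.1 hc).2]
  · refine Nat.cast_ne_zero.2 (Finset.card_ne_zero.2 ⟨0, ?_⟩)
    simp

theorem ensembleMean_mono {X Y : Matrix (Fin m) (Fin n) F → ℝ} (h : ∀ H, X H ≤ Y H) :
    ensembleMean X ≤ ensembleMean Y := by
  simp only [ensembleMean]
  gcongr with H
  exact h H

theorem card_matrix_pos : (0 : ℝ) < Fintype.card (Matrix (Fin m) (Fin n) F) := by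
  exact_mod_cast Fintype.card_pos

theorem ensembleProb_add_not (A : Matrix (Fin m) (Fin n) F → Prop) :
    ensembleProb A + ensembleProb (fun H => ¬ A H) = 1 := by
  classical
  rw [ensembleProb_eq_mean A, ensembleProb_eq_mean fun H => ¬ A H, ensembleMean, ensembleMean,
    ← add_div, div_eq_one_iff_eq card_matrix_pos.ne', ← Finset.sum_add_distrib,
    Finset.sum_congr rfl (g := fun _ => (1 : ℝ))]
  · simp
  · intro H _
    by_cases h : A H <;> simp [h]

theorem cov_recoverable_le (E E' : Finset (Fin n)) :
    ensembleProb (fun H : Matrix (Fin m) (Fin n) F => Recoverable H E ∧ Recoverable H E') -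
      ensembleProb (fun H : Matrix (Fin m) (Fin n) F => Recoverable H E) *
        ensembleProb (fun H : Matrix (Fin m) (Fin n) F => Recoverable H E')
      ≤ (Fintype.card F : ℝ) ^ (E ∩ E').card / (Fintype.card F : ℝ) ^ m := by
  classical
  have hq : (0 : ℝ) < (Fintype.card F : ℝ) ^ m := by
    have : (0 : ℝ) < Fintype.card F := by exact_mod_cast Fintype.card_pos
    positivity
  have hN := card_matrix_pos (F := F) (m := m) (n := n)
  set S : (Matrix (Fin m) (Fin n) F → Prop) → ℝ := fun A => ∑ H, if A H then 1 else 0 with hS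
  have hprob : ∀ A : Matrix (Fin m) (Fin n) F → Prop,
      ensembleProb A = S A / Fintype.card (Matrix (Fin m) (Fin n) F) := fun A =>
    ensembleProb_eq_mean A
  have hmul : S (fun H => Recoverable H (E ∩ E')) * S (fun H => Recoverable H E ∧ Recoverable H E')
      = S (fun H => Recoverable H E) * S (fun H => Recoverable H E') := by
    convert sum_recoverable_and (F := F) (m := m) E E'
  have hnot := sum_not_recoverable_le (F := F) (m := m) (E ∩ E')
  have hcompl : ∑ H : Matrix (Fin m) (Fin n) F, (if Recoverable H (E ∩ E') then (0 : ℝ) else 1)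
      = Fintype.card (Matrix (Fin m) (Fin n) F) - S (fun H => Recoverable H (E ∩ E')) := by
    rw [eq_sub_iff_add_eq, hS, ← Finset.sum_add_distrib,
      Finset.sum_congr rfl (g := fun _ => (1 : ℝ))]
    · simp
    · intro H _; split_ifs <;> simp
  rw [hcompl] at hnot
  have hle : S (fun H => Recoverable H E ∧ Recoverable H E')
      ≤ Fintype.card (Matrix (Fin m) (Fin n) F) := by
    simp only [hS, Finset.sum_boole]
    exact_mod_cast Finset.card_le_univ _
  have hle' : S (fun H => Recoverable H (E ∩ E'))
      ≤ Fintype.card (Matrix (Fin m) (Fin n) F) := by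
    simp only [hS, Finset.sum_boole]
    exact_mod_cast Finset.card_le_univ _
  simp only [hprob]
  rw [div_mul_div_comm, ← hmul]
  set N : ℝ := (Fintype.card (Matrix (Fin m) (Fin n) F) : ℝ)
  set a := S (fun H => Recoverable H (E ∩ E'))
  set b := S (fun H => Recoverable H E ∧ Recoverable H E')
  -- The covariance is the joint probability times the failure probability on `E ∩ E'`.
  have e : b / N - a * b / (N * N) = b / N * ((N - a) / N) := by field_simp
  rw [e]
  calc b / N * ((N - a) / N) ≤ 1 * ((N - a) / N) := by
        refine mul_le_mul_of_nonneg_right ((div_le_one hN).2 hle)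
          (div_nonneg (by linarith) hN.le)
    _ ≤ _ := by
        rw [one_mul, div_le_div_iff₀ hN hq]
        linarith

/-- If either set has more than `m` elements, both probabilities on the left vanish. Otherwise the
extra factor `t ^ (#E + #E' - 2m)` is at least `1`. -/
theorem cov_recoverable_le_tilted (E E' : Finset (Fin n)) {t : ℝ} (ht0 : 0 < t) (ht1 : t ≤ 1) :
    ensembleProb (fun H : Matrix (Fin m) (Fin n) F => Recoverable H E ∧ Recoverable H E') -
      ensembleProb (fun H : Matrix (Fin m) (Fin n) F => Recoverable H E) *
        ensembleProb (fun H : Matrix (Fin m) (Fin n) F => Recoverable H E')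
      ≤ (t ^ E.card * t ^ E'.card * (Fintype.card F : ℝ) ^ (E ∩ E').card) /
        (t ^ (2 * m) * (Fintype.card F : ℝ) ^ m) := by
  by_cases hE : m < E.card
  · rw [ensembleProb_eq_zero fun H h => not_recoverable_of_card_lt H hE h.1,
      ensembleProb_eq_zero fun H h => not_recoverable_of_card_lt H hE h]
    rw [zero_mul, sub_zero]
    positivity
  by_cases hE' : m < E'.card
  · rw [ensembleProb_eq_zero fun H h => not_recoverable_of_card_lt H hE' h.2,
      ensembleProb_eq_zero (A := fun H : Matrix (Fin m) (Fin n) F => Recoverable H E')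
        fun H h => not_recoverable_of_card_lt H hE' h]
    rw [mul_zero, sub_zero]
    positivity
  refine (cov_recoverable_le E E').trans ?_
  rw [mul_div_mul_comm]
  refine le_mul_of_one_le_left (by positivity) ((one_le_div (by positivity)).2 ?_)
  rw [← pow_add]
  exact pow_le_pow_of_le_one ht0.le ht1 (by omega)

theorem variance_eq (ε : ℝ) :
    ensembleMean (fun H : Matrix (Fin m) (Fin n) F => (pUdMatrix H ε - pUdEnsemble F m n ε) ^ 2)
      = ∑ E : Finset (Fin n), ∑ E' : Finset (Fin n),
        (ε ^ E.card * (1 - ε) ^ (n - E.card)) * (ε ^ E'.card * (1 - ε) ^ (n - E'.card)) *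
        (ensembleProb (fun H : Matrix (Fin m) (Fin n) F => Recoverable H E ∧ Recoverable H E') -
          ensembleProb (fun H : Matrix (Fin m) (Fin n) F => Recoverable H E) *
          ensembleProb (fun H : Matrix (Fin m) (Fin n) F => Recoverable H E')) := by
  classical
  set w : Finset (Fin n) → ℝ := fun E => ε ^ E.card * (1 - ε) ^ (n - E.card) with hw
  set P : Finset (Fin n) → ℝ := fun E =>
    ensembleProb (fun H : Matrix (Fin m) (Fin n) F => Recoverable H E) with hP
  have hN := (card_matrix_pos (F := F) (m := m) (n := n)).ne'
  have hsub : ∀ H : Matrix (Fin m) (Fin n) F, pUdMatrix H ε - pUdEnsemble F m n ε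
      = ∑ E, w E * (P E - if Recoverable H E then 1 else 0) := by
    intro H
    have hmean : pUdEnsemble F m n ε = ∑ E, w E * (1 - P E) := by
      simp only [pUdEnsemble, pUdMatrix_eq]
      rw [ensembleMean_sum]
      refine Finset.sum_congr rfl fun E _ => ?_
      rw [ensembleMean_const_mul]
      congr 1
      rw [eq_sub_iff_add_eq, hP]
      simp only [ensembleProb_eq_mean, ensembleMean]
      rw [← add_div, ← Finset.sum_add_distrib, div_eq_one_iff_eq hN,
        Finset.sum_congr rfl (g := fun _ => (1 : ℝ))]
      · simp
      · intro H _; split_ifs <;> simp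
    rw [hmean, pUdMatrix_eq, ← Finset.sum_sub_distrib]
    refine Finset.sum_congr rfl fun E _ => ?_
    simp only [hw]
    split_ifs <;> ring
  have hsq : ∀ H : Matrix (Fin m) (Fin n) F, (pUdMatrix H ε - pUdEnsemble F m n ε) ^ 2
      = ∑ E, ∑ E', w E * w E' * ((P E - if Recoverable H E then 1 else 0) *
          (P E' - if Recoverable H E' then 1 else 0)) := by
    intro H
    rw [hsub, sq, Finset.sum_mul_sum]
    exact Finset.sum_congr rfl fun E _ => Finset.sum_congr rfl fun E' _ => by ring
  simp only [hsq]
  rw [ensembleMean_sum]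
  refine Finset.sum_congr rfl fun E _ => ?_
  rw [ensembleMean_sum]
  refine Finset.sum_congr rfl fun E' _ => ?_
  rw [ensembleMean_const_mul]
  congr 1
  have hexp : ∀ H : Matrix (Fin m) (Fin n) F, (P E - if Recoverable H E then (1 : ℝ) else 0) *
      (P E' - if Recoverable H E' then 1 else 0)
      = P E * P E' - P E * (if Recoverable H E' then 1 else 0)
        - P E' * (if Recoverable H E then 1 else 0)
        + (if Recoverable H E ∧ Recoverable H E' then 1 else 0) := by
    intro H
    by_cases h : Recoverable H E <;> by_cases h' : Recoverable H E' <;> simp [h, h'] <;> ring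
  have hPN : ∀ E, P E = (∑ H : Matrix (Fin m) (Fin n) F, if Recoverable H E then (1 : ℝ) else 0) /
      Fintype.card (Matrix (Fin m) (Fin n) F) := fun E => ensembleProb_eq_mean _
  change _ = _ - P E * P E'
  simp only [hexp, ensembleProb_eq_mean (fun H => Recoverable H E ∧ Recoverable H E'),
    ensembleMean, Finset.sum_add_distrib, Finset.sum_sub_distrib, ← Finset.mul_sum,
    Finset.sum_const, nsmul_eq_mul, Finset.card_univ]
  rw [hPN E, hPN E']
  field_simp
  ring

/-- Each position independently lies in neither set, in exactly one, or in both, contributing `a²`,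
`2ab` or `q b²`. -/
theorem sum_pair_weights (a b q : ℝ) (n : ℕ) :
    ∑ E : Finset (Fin n), ∑ E' : Finset (Fin n),
      (b ^ E.card * a ^ (n - E.card)) * (b ^ E'.card * a ^ (n - E'.card)) * q ^ (E ∩ E').card
      = (a ^ 2 + 2 * a * b + q * b ^ 2) ^ n := by
  have hinner : ∀ E : Finset (Fin n), ∑ E' : Finset (Fin n),
      b ^ E'.card * a ^ (n - E'.card) * q ^ (E ∩ E').card
      = (q * b + a) ^ E.card * (b + a) ^ (n - E.card) := by
    intro E
    have h := Finset.prod_add (fun i : Fin n => b * if i ∈ E then q else 1) (fun _ => a)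
      Finset.univ
    have hL : ∏ i : Fin n, ((b * if i ∈ E then q else 1) + a)
        = (q * b + a) ^ E.card * (b + a) ^ (n - E.card) := by
      rw [← Finset.prod_mul_prod_compl E, Finset.prod_congr rfl (g := fun _ => q * b + a),
        Finset.prod_congr (s₁ := Eᶜ) rfl (g := fun _ => b + a)]
      · simp [Finset.card_compl]
      · intro i hi; simp [Finset.mem_compl.1 hi]
      · intro i hi; simp [hi, mul_comm]
    rw [← hL, h, Finset.powerset_univ]
    refine Finset.sum_congr rfl fun E' _ => ?_
    rw [Finset.prod_mul_distrib, Finset.prod_const, Finset.prod_const,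
      Finset.prod_ite_mem, Finset.prod_const, ← Finset.compl_eq_univ_sdiff, Finset.card_compl,
      Fintype.card_fin, Finset.inter_comm E E']
    ring
  have hfin := Fintype.sum_pow_mul_eq_add_pow (Fin n) (b * (q * b + a)) (a * (b + a))
  rw [Fintype.card_fin] at hfin
  rw [show a ^ 2 + 2 * a * b + q * b ^ 2 = b * (q * b + a) + a * (b + a) by ring, ← hfin]
  refine Finset.sum_congr rfl fun E _ => ?_
  rw [mul_pow, mul_pow]
  calc _ = (b ^ E.card * a ^ (n - E.card)) * ∑ E' : Finset (Fin n),
        b ^ E'.card * a ^ (n - E'.card) * q ^ (E ∩ E').card := by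
        rw [Finset.mul_sum]
        exact Finset.sum_congr rfl fun E' _ => by ring
    _ = _ := by rw [hinner]; ring

theorem variance_le {ε t : ℝ} (hε0 : 0 < ε) (hε1 : ε < 1) (ht0 : 0 < t) (ht1 : t ≤ 1) :
    ensembleMean (fun H : Matrix (Fin m) (Fin n) F => (pUdMatrix H ε - pUdEnsemble F m n ε) ^ 2)
      ≤ ((1 - ε) ^ 2 + 2 * (1 - ε) * (ε * t) + (Fintype.card F : ℝ) * (ε * t) ^ 2) ^ n /
        (t ^ (2 * m) * (Fintype.card F : ℝ) ^ m) := by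
  have hε' : 0 < 1 - ε := by linarith
  rw [variance_eq, ← sum_pair_weights, Finset.sum_div]
  refine Finset.sum_le_sum fun E _ => ?_
  rw [Finset.sum_div]
  refine Finset.sum_le_sum fun E' _ => ?_
  refine (mul_le_mul_of_nonneg_left (cov_recoverable_le_tilted E E' ht0 ht1)
    (by positivity)).trans_eq ?_
  rw [mul_pow, mul_pow]
  ring

theorem le_pUdEnsemble {ε : ℝ} (hε0 : 0 < ε) (hε1 : ε < 1) {k : ℕ} (hk : m < k) :
    (n.choose k : ℝ) * (ε ^ k * (1 - ε) ^ (n - k)) ≤ pUdEnsemble F m n ε := by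
  classical
  have hε' : 0 < 1 - ε := by linarith
  have hN := (card_matrix_pos (F := F) (m := m) (n := n)).ne'
  have hH : ∀ H : Matrix (Fin m) (Fin n) F,
      (n.choose k : ℝ) * (ε ^ k * (1 - ε) ^ (n - k)) ≤ pUdMatrix H ε := by
    intro H
    rw [pUdMatrix_eq]
    refine le_trans (le_of_eq ?_) (Finset.sum_le_sum_of_subset_of_nonneg
      (Finset.subset_univ (Finset.powersetCard k Finset.univ)) fun E _ _ => ?_)
    · rw [Finset.sum_congr rfl (g := fun _ => ε ^ k * (1 - ε) ^ (n - k))]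
      · simp
      · intro E hE
        rw [(Finset.mem_powersetCard.1 hE).2, if_neg (not_recoverable_of_card_lt H ?_), mul_one]
        rwa [(Finset.mem_powersetCard.1 hE).2]
    · split_ifs <;> positivity
  refine le_trans (le_of_eq ?_) (ensembleMean_mono hH)
  simp [ensembleMean, hN]

/-- Chebyshev's inequality for the relative deviation of `pUdMatrix` from its mean. -/
theorem prob_relative_deviation_ge {ε δ : ℝ} (hδ : 0 < δ) (hpos : 0 < pUdEnsemble F m n ε) :
    1 - ensembleMean (fun H : Matrix (Fin m) (Fin n) F =>
        (pUdMatrix H ε - pUdEnsemble F m n ε) ^ 2) / (δ * pUdEnsemble F m n ε) ^ 2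
      ≤ ensembleProb (fun H : Matrix (Fin m) (Fin n) F =>
        |pUdMatrix H ε / pUdEnsemble F m n ε - 1| < δ) := by
  classical
  refine (sub_le_sub_left ?_ 1).trans_eq (sub_eq_of_eq_add (ensembleProb_add_not
    fun H : Matrix (Fin m) (Fin n) F => |pUdMatrix H ε / pUdEnsemble F m n ε - 1| < δ).symm)
  rw [le_div_iff₀ (by positivity), mul_comm, ensembleProb_eq_mean, ← ensembleMean_const_mul]
  refine ensembleMean_mono fun H => ?_
  split_ifs with h
  · rw [mul_zero]
    positivity
  · rw [not_lt] at h
    rw [mul_one, ← sq_abs (pUdMatrix H ε - _)]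
    have e : pUdMatrix H ε - pUdEnsemble F m n ε
        = (pUdMatrix H ε / pUdEnsemble F m n ε - 1) * pUdEnsemble F m n ε := by
      field_simp
    rw [e, abs_mul, abs_of_pos hpos]
    gcongr

end Variance


/-! ### Binomial weights near the mode -/

/-- A sequence of binomial weights with parameter `v` dominates, up to a factor `4`, near its mode. -/
theorem choose_mul_pow_le {n m : ℕ} {μ v : ℝ} (hμ0 : 0 < μ) (hμ1 : μ < 1) (hv : v = μ / (1 - μ))
    (hm : |(m : ℝ) - μ * n| < 1) (hn : 2 + 2 * v ≤ μ * n) (hmn : m + 1 ≤ n) (j : ℕ) :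
    (n.choose j : ℝ) * v ^ j ≤ 4 * ((n.choose (m + 1) : ℝ) * v ^ (m + 1)) := by
  have hμ' : 0 < 1 - μ := by linarith
  have hv0 : 0 < v := by rw [hv]; positivity
  have hvμ : v * (1 - μ) = μ := by rw [hv]; field_simp
  obtain ⟨hm1, hm2⟩ := abs_lt.1 hm
  set a : ℕ → ℝ := fun j => (n.choose j : ℝ) * v ^ j with ha
  have ha0 : ∀ j, 0 ≤ a j := fun j => by simp only [ha]; positivity
  -- Consecutive terms have ratio `(n - j) v / (j + 1)`, which crosses `1` near `j = μ n`. As `m` is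
  -- only within `1` of `μ n`, the terms are known to increase up to index `m - 1` and to decrease
  -- from `m + 1`. Each of the two steps between loses at most a factor `2`, hence the `4`.
  have hstep : ∀ j, j ≤ n → ((j : ℝ) + 1) * a (j + 1) = ((n : ℝ) - j) * v * a j := by
    intro j hj
    have h := Nat.choose_succ_right_eq n j
    have h' : (n.choose (j + 1) : ℝ) * ((j : ℝ) + 1) = n.choose j * ((n : ℝ) - j) := by
      have := congrArg (Nat.cast : ℕ → ℝ) h
      push_cast [Nat.cast_sub hj] at this
      exact this
    simp only [ha, pow_succ]
    linear_combination v ^ j * v * h'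
  have hup : ∀ j, j + 2 ≤ m → a j ≤ a (j + 1) := by
    intro j hj
    have hj' : (j : ℝ) + 2 ≤ m := by exact_mod_cast hj
    have h := hstep j (by omega)
    have h2 : (j : ℝ) + 1 ≤ ((n : ℝ) - j) * v := by
      have : ((j : ℝ) + 1) * (1 - μ) ≤ ((n : ℝ) - j) * v * (1 - μ) := by
        rw [mul_assoc, hvμ]; nlinarith
      exact le_of_mul_le_mul_right this hμ'
    have h3 : ((j : ℝ) + 1) * a j ≤ ((j : ℝ) + 1) * a (j + 1) := by
      rw [h]; exact mul_le_mul_of_nonneg_right h2 (ha0 j)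
    exact le_of_mul_le_mul_left h3 (by positivity)
  have hdown : ∀ j, m + 1 ≤ j → a (j + 1) ≤ a j := by
    intro j hj
    have hj' : (m : ℝ) + 1 ≤ j := by exact_mod_cast hj
    rcases le_or_gt j n with hjn | hjn
    · have h := hstep j hjn
      have h2 : ((n : ℝ) - j) * v ≤ (j : ℝ) + 1 := by
        have : ((n : ℝ) - j) * v * (1 - μ) ≤ ((j : ℝ) + 1) * (1 - μ) := by
          rw [mul_assoc, hvμ]; nlinarith
        exact le_of_mul_le_mul_right this hμ'
      have h3 : ((j : ℝ) + 1) * a (j + 1) ≤ ((j : ℝ) + 1) * a j := by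
        rw [h]; exact mul_le_mul_of_nonneg_right h2 (ha0 j)
      exact le_of_mul_le_mul_left h3 (by positivity)
    · simp [ha, Nat.choose_eq_zero_of_lt hjn, Nat.choose_eq_zero_of_lt (hjn.trans (Nat.lt_succ_self j))]
  have hhalf : ∀ j, j ≤ m → a j ≤ 2 * a (j + 1) := by
    intro j hj
    have hj' : (j : ℝ) ≤ m := by exact_mod_cast hj
    have h := hstep j (by omega)
    have h2 : (j : ℝ) + 1 ≤ 2 * (((n : ℝ) - j) * v) := by
      have : ((j : ℝ) + 1) * (1 - μ) ≤ 2 * (((n : ℝ) - j) * v) * (1 - μ) := by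
        have e : 2 * (((n : ℝ) - j) * v) * (1 - μ) = 2 * (((n : ℝ) - j) * μ) := by
          linear_combination 2 * ((n : ℝ) - j) * hvμ
        rw [e]
        have : 2 * (1 - μ) + 2 * μ ≤ μ * n * (1 - μ) := by
          calc _ = (2 + 2 * v) * (1 - μ) := by linear_combination (-2) * hvμ
            _ ≤ _ := mul_le_mul_of_nonneg_right hn hμ'.le
        nlinarith
      exact le_of_mul_le_mul_right this hμ'
    have h3 : ((j : ℝ) + 1) * a j ≤ ((j : ℝ) + 1) * (2 * a (j + 1)) := by
      have := mul_le_mul_of_nonneg_right h2 (ha0 j)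
      linarith
    exact le_of_mul_le_mul_left h3 (by positivity)
  have hge : ∀ j, m + 1 ≤ j → a j ≤ a (m + 1) := fun j hj => by
    induction j, hj using Nat.le_induction with
    | base => exact le_rfl
    | succ j hj ih => exact (hdown j hj).trans ih
  have hle : ∀ d, d + 1 ≤ m → a (m - 1 - d) ≤ a (m - 1) := fun d => by
    induction d with
    | zero => intro _; simp
    | succ d ih =>
      intro hd
      refine le_trans ?_ (ih (by omega))
      have := hup (m - 1 - (d + 1)) (by omega)
      rwa [show m - 1 - (d + 1) + 1 = m - 1 - d by omega] at this
  change a j ≤ 4 * a (m + 1)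
  rcases le_or_gt (m + 1) j with h | h
  · linarith [hge j h, ha0 (m + 1)]
  · rcases eq_or_ne j m with rfl | hjm
    · linarith [hhalf j le_rfl, ha0 (j + 1)]
    · have h1 := hle (m - 1 - j) (by omega)
      rw [show m - 1 - (m - 1 - j) = j by omega] at h1
      have h2 := hhalf (m - 1) (by omega)
      rw [show m - 1 + 1 = m by omega] at h2
      linarith [hhalf m le_rfl]

theorem one_add_pow_le {n m : ℕ} {μ v : ℝ} (hμ0 : 0 < μ) (hμ1 : μ < 1) (hv : v = μ / (1 - μ))
    (hm : |(m : ℝ) - μ * n| < 1) (hn : 2 + 2 * v ≤ μ * n) (hmn : m + 1 ≤ n) :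
    (1 + v) ^ n ≤ 4 * ((n : ℝ) + 1) * ((n.choose (m + 1) : ℝ) * v ^ (m + 1)) := by
  have : (1 + v) ^ n = ∑ j ∈ Finset.range (n + 1), (n.choose j : ℝ) * v ^ j := by
    rw [add_comm, add_pow]
    exact Finset.sum_congr rfl fun j _ => by ring
  rw [this]
  refine (Finset.sum_le_sum fun j _ => choose_mul_pow_le hμ0 hμ1 hv hm hn hmn j).trans_eq ?_
  simp; ring

/-! ### Inequalities for the exponential rate -/

/-- The difference of the two sides vanishes at `1`, increases up to `2`, then decreases, and is
still positive at `4`. This is where the restriction `q ≤ 4` enters. -/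
theorem log_lt_two_mul_one_sub_inv {y : ℝ} (h1 : 1 < y) (h4 : y ≤ 4) :
    Real.log y < 2 * (1 - y⁻¹) := by
  have hd : ∀ x : ℝ, 0 < x →
      HasDerivAt (fun x => 2 * (1 - x⁻¹) - Real.log x) ((2 - x) / x ^ 2) x := by
    intro x hx
    have h := (((hasDerivAt_inv hx.ne').const_sub 1).const_mul 2).sub
      (Real.hasDerivAt_log hx.ne')
    refine h.congr_deriv ?_
    field_simp
  rcases le_or_gt y 2 with h2 | h2
  · have hmono : StrictMonoOn (fun x : ℝ => 2 * (1 - x⁻¹) - Real.log x) (Set.Icc 1 2) := by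
      refine strictMonoOn_of_deriv_pos (convex_Icc 1 2)
        (fun x hx => (hd x (by linarith [hx.1])).continuousAt.continuousWithinAt) fun x hx => ?_
      rw [interior_Icc] at hx
      have hx0 : 0 < x := by linarith [hx.1]
      rw [(hd x hx0).deriv]
      have : 0 < 2 - x := by linarith [hx.2]
      positivity
    have := hmono (Set.mem_Icc.2 ⟨le_rfl, by norm_num⟩) (Set.mem_Icc.2 ⟨h1.le, h2⟩) h1
    simp at this
    linarith
  · have hanti : AntitoneOn (fun x : ℝ => 2 * (1 - x⁻¹) - Real.log x) (Set.Icc 2 4) := by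
      refine antitoneOn_of_deriv_nonpos (convex_Icc 2 4)
        (fun x hx => (hd x (by linarith [hx.1])).continuousAt.continuousWithinAt)
        (fun x hx => ?_) fun x hx => ?_
      · rw [interior_Icc] at hx
        exact (hd x (by linarith [hx.1])).differentiableAt.differentiableWithinAt
      · rw [interior_Icc] at hx
        have hx0 : 0 < x := by linarith [hx.1]
        rw [(hd x hx0).deriv]
        exact div_nonpos_of_nonpos_of_nonneg (by linarith [hx.1]) (by positivity)
    have := hanti (Set.mem_Icc.2 ⟨h2.le, h4⟩) (Set.mem_Icc.2 ⟨by norm_num, le_rfl⟩) h4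
    simp only at this
    have h4' : Real.log 4 < 3 / 2 := by
      have : (4 : ℝ) = 2 ^ 2 := by norm_num
      rw [this, Real.log_pow]
      have := Real.log_two_lt_d9
      push_cast
      linarith
    norm_num at this
    linarith

/-- Equality holds at `ρ = 1`, and `log (1 + (q - 1) x²) / x` is strictly increasing: with `y = 1 +
(q - 1) x² ≤ 4`, the numerator of its derivative is `2 (1 - 1/y) - log y`. -/
theorem one_add_mul_sq_lt_rpow {q : ℝ} (hq1 : 1 < q) (hq4 : q ≤ 4) {ρ : ℝ} (h0 : 0 < ρ)
    (h1 : ρ < 1) : 1 + (q - 1) * ρ ^ 2 < q ^ ρ := by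
  have hq' : 0 < q - 1 := by linarith
  have hd : ∀ x : ℝ, 0 < x → HasDerivAt (fun x => Real.log (1 + (q - 1) * x ^ 2) / x)
      (((q - 1) * (2 * x) / (1 + (q - 1) * x ^ 2) * x - Real.log (1 + (q - 1) * x ^ 2)) / x ^ 2)
      x := by
    intro x hx
    have hy : 0 < 1 + (q - 1) * x ^ 2 := by positivity
    have h := ((((hasDerivAt_pow 2 x).const_mul (q - 1)).const_add 1).log hy.ne').div
      (hasDerivAt_id x) hx.ne'
    refine h.congr_deriv ?_
    simp
  have hmono : StrictMonoOn (fun x => Real.log (1 + (q - 1) * x ^ 2) / x) (Set.Icc ρ 1) := by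
    refine strictMonoOn_of_deriv_pos (convex_Icc ρ 1)
      (fun x hx => (hd x (by linarith [hx.1])).continuousAt.continuousWithinAt) fun x hx => ?_
    rw [interior_Icc] at hx
    have hx0 : 0 < x := h0.trans hx.1
    rw [(hd x hx0).deriv]
    have hxx : x ^ 2 ≤ 1 := by nlinarith [hx.2]
    have hy1 : 1 < 1 + (q - 1) * x ^ 2 := by
      have : 0 < (q - 1) * x ^ 2 := by positivity
      linarith
    have hlog := log_lt_two_mul_one_sub_inv hy1 (by nlinarith)
    have e : (q - 1) * (2 * x) / (1 + (q - 1) * x ^ 2) * x = 2 * (1 - (1 + (q - 1) * x ^ 2)⁻¹) := by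
      field_simp
      ring
    rw [e]
    exact div_pos (by linarith) (by positivity)
  have h := hmono (Set.mem_Icc.2 ⟨le_rfl, h1.le⟩) (Set.mem_Icc.2 ⟨h1.le, le_rfl⟩) h1
  simp only [one_pow, mul_one, div_one, add_sub_cancel] at h
  rw [div_lt_iff₀ h0] at h
  have hy : 0 < 1 + (q - 1) * ρ ^ 2 := by positivity
  rw [← Real.log_lt_log_iff hy (by positivity), Real.log_rpow (by linarith)]
  linarith

/-- The exponential rate at which the normalized second moment decays, tilted at `u`, is below `1`. -/
theorem exists_tilt {q ε R : ℝ} (hq : 1 < q) (hε0 : 0 < ε) (hε1 : ε < 1) (hR0 : 0 < R)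
    (hR1 : R < 1)
    (hcond : (1 - ε) / (1 + (q - 1) * ε ^ 2) ≤ R ∨ (q ≤ 4 ∧ (1 - ε) / (1 + (q - 1) * ε) ≤ R)) :
    ∃ u, 0 < u ∧ u ≤ ε / (1 - ε) ∧
      (((1 - R) / R) ^ 2 / (q * u ^ 2)) ^ (1 - R) * (1 + 2 * u + q * u ^ 2)
        < (1 + (1 - R) / R) ^ 2 := by
  have hq0 : 0 < q := by linarith
  have hq' : 0 < q - 1 := by linarith
  have hε' : 0 < 1 - ε := by linarith
  have hR' : 0 < 1 - R := by linarith
  have hsum : 1 + (1 - R) / R = 1 / R := by field_simp; ring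
  rcases hcond with h | ⟨hq4, h⟩
  -- Here `u` is the stationary point of the rate, given by `u (1 + q u) / (1 + u) = v`; the
  -- condition on `R` is equivalent to this left side being at least `v` at `u = θ`.
  · set θ := ε / (1 - ε) with hθ
    have hθ0 : 0 < θ := by positivity
    have hvle : (1 - R) / R ≤ θ * (1 + q * θ) / (1 + θ) := by
      rw [div_le_iff₀ (by positivity)] at h
      have e : θ * (1 + q * θ) / (1 + θ) = ε * (1 - ε + q * ε) / (1 - ε) := by
        rw [hθ]; field_simp; ring
      rw [e, div_le_div_iff₀ hR0 hε']
      nlinarith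
    have hcont : ContinuousOn (fun u : ℝ => u * (1 + q * u) / (1 + u)) (Set.Icc 0 θ) := by
      refine ContinuousOn.div (by fun_prop) (by fun_prop) fun x hx => ?_
      linarith [hx.1]
    obtain ⟨u, ⟨hu0, hu1⟩, hu⟩ := intermediate_value_Icc hθ0.le hcont
      (show (1 - R) / R ∈ Set.Icc _ _ from ⟨by simp; positivity, hvle⟩)
    simp only at hu
    have hu0 : 0 < u := by
      rcases hu0.eq_or_lt with h0 | h0
      · rw [← h0] at hu
        have : 0 < (1 - R) / R := by positivity
        simp only [zero_mul, zero_div] at hu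
        linarith
      · exact h0
    refine ⟨u, hu0, hu1, ?_⟩
    have hA : 0 < 1 + 2 * u + q * u ^ 2 := by positivity
    have hu' : u * (1 + q * u) * R = (1 - R) * (1 + u) := by
      field_simp at hu; linarith
    have hRA : R * (1 + 2 * u + q * u ^ 2) = 1 + u := by linear_combination hu'
    have hReq : R = (1 + u) / (1 + 2 * u + q * u ^ 2) := by rw [← hRA]; field_simp
    have hw : ((1 - R) / R) ^ 2 / (q * u ^ 2) = 1 + (q - 1) * (q * u ^ 2 - 1) / (q * (1 + u) ^ 2) := by
      rw [← hu]; field_simp; ring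
    have hs : -1 ≤ (q - 1) * (q * u ^ 2 - 1) / (q * (1 + u) ^ 2) := by
      have : 0 ≤ ((1 - R) / R) ^ 2 / (q * u ^ 2) := by positivity
      linarith
    -- Bernoulli's inequality for the exponent `1 - R` makes the claim rational in `u` and `q`.
    have hbern := rpow_one_add_le_one_add_mul_self hs hR'.le (by linarith)
    rw [hw, hsum]
    refine (mul_le_mul_of_nonneg_right hbern hA.le).trans_lt ?_
    have h1R : 1 - R = u * (1 + q * u) / (1 + 2 * u + q * u ^ 2) := by
      rw [hReq]; field_simp; ring
    rw [h1R, hReq]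
    rw [← sub_pos]
    have : (1 / ((1 + u) / (1 + 2 * u + q * u ^ 2))) ^ 2 - (1 + u * (1 + q * u) / (1 + 2 * u + q * u ^ 2) *
        ((q - 1) * (q * u ^ 2 - 1) / (q * (1 + u) ^ 2))) * (1 + 2 * u + q * u ^ 2)
        = (q - 1) * u * (1 + 2 * q * u + q * u ^ 2) / (q * (1 + u) ^ 2) := by
      field_simp
      ring
    rw [this]
    positivity
  -- The choice `u = v / q` makes the base of the power exactly `q`, reducing the claim to `1 + (q -
  -- 1) R² < q ^ R`; the condition on `R` is equivalent to `u ≤ ε / (1 - ε)`.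
  · refine ⟨(1 - R) / R / q, by positivity, ?_, ?_⟩
    · rw [div_le_iff₀ (by positivity)] at h
      rw [div_div, div_le_div_iff₀ (by positivity) hε']
      nlinarith
    · have e1 : ((1 - R) / R) ^ 2 / (q * ((1 - R) / R / q) ^ 2) = q := by
        field_simp
      have e2 : 1 + 2 * ((1 - R) / R / q) + q * ((1 - R) / R / q) ^ 2
          = (1 + (q - 1) * R ^ 2) / (q * R ^ 2) := by
        field_simp; ring
      rw [e1, e2, hsum]
      have h3 := one_add_mul_sq_lt_rpow hq hq4 hR0 hR1
      have h4 : q ^ (1 - R) * q ^ R = q := by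
        rw [← Real.rpow_add hq0]; simp
      have h5 : 0 < q ^ (1 - R) := by positivity
      have h6 : q ^ (1 - R) * (1 + (q - 1) * R ^ 2) < q := by
        calc _ < q ^ (1 - R) * q ^ R := by gcongr
          _ = q := h4
      rw [← mul_div_assoc, div_lt_iff₀ (by positivity)]
      calc _ < q := h6
        _ = _ := by field_simp


/-! ### Exponential decay and conclusion -/

theorem relative_variance_le {F : Type*} [Field F] [Fintype F] {m n : ℕ} {ε R u : ℝ}
    (hε0 : 0 < ε) (hε1 : ε < 1) (hR0 : 0 < R) (hR1 : R < 1) (hu0 : 0 < u)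
    (hu1 : u ≤ ε / (1 - ε)) (hm : |(m : ℝ) - (1 - R) * n| < 1)
    (hn : 2 + 2 * ((1 - R) / R) ≤ (1 - R) * n) (hmn : m + 1 ≤ n) :
    0 < pUdEnsemble F m n ε ∧
    ensembleMean (fun H : Matrix (Fin m) (Fin n) F => (pUdMatrix H ε - pUdEnsemble F m n ε) ^ 2)
      ≤ 16 * ((n : ℝ) + 1) ^ 2 * ((1 - R) / R / (ε / (1 - ε))) ^ 2 *
        (((1 - R) / R) ^ 2 / ((Fintype.card F : ℝ) * u ^ 2)) ^ m *
        ((1 + 2 * u + (Fintype.card F : ℝ) * u ^ 2) / (1 + (1 - R) / R) ^ 2) ^ n *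
        pUdEnsemble F m n ε ^ 2 := by
  have hε' : 0 < 1 - ε := by linarith
  have hR' : 0 < 1 - R := by linarith
  have hq : (0 : ℝ) < Fintype.card F := by exact_mod_cast Fintype.card_pos
  set q : ℝ := (Fintype.card F : ℝ) with hqdef
  set θ := ε / (1 - ε) with hθ
  set v := (1 - R) / R with hv
  have hθ0 : 0 < θ := by positivity
  have hv0 : 0 < v := by positivity
  set X := pUdEnsemble F m n ε
  have hεθ : ε = θ * (1 - ε) := by rw [hθ]; field_simp
  have hchoose := one_add_pow_le (v := v) hR' (by linarith) (by rw [hv]; ring_nf) hm hn hmn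
  have hX := le_pUdEnsemble (F := F) (n := n) hε0 hε1 (Nat.lt_succ_self m)
  have hXY : (1 + v) ^ n * θ ^ (m + 1) * (1 - ε) ^ n / (4 * ((n : ℝ) + 1) * v ^ (m + 1)) ≤ X := by
    refine le_trans ?_ hX
    rw [div_le_iff₀ (by positivity)]
    have e : ε ^ (m + 1) * (1 - ε) ^ (n - (m + 1)) = θ ^ (m + 1) * (1 - ε) ^ n := by
      conv_lhs => rw [hεθ]
      rw [mul_pow, mul_assoc, ← hεθ, ← pow_add, Nat.add_sub_cancel' hmn]
    rw [Nat.succ_eq_add_one, e]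
    calc _ = (1 + v) ^ n * (θ ^ (m + 1) * (1 - ε) ^ n) := by ring
      _ ≤ 4 * ((n : ℝ) + 1) * ((n.choose (m + 1) : ℝ) * v ^ (m + 1)) *
          (θ ^ (m + 1) * (1 - ε) ^ n) := by gcongr
      _ = _ := by ring
  have hX0 : 0 < X := lt_of_lt_of_le (by positivity) hXY
  refine ⟨hX0, ?_⟩
  -- The tilt is `t = u / θ`, so that `ε t = (1 - ε) u` and the powers of `1 - ε` cancel against the
  -- squared mean.
  have hV := variance_le (F := F) (m := m) (n := n) hε0 hε1 (t := u / θ) (by positivity)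
    ((div_le_one hθ0).2 hu1)
  rw [← hqdef] at hV
  refine hV.trans ?_
  have e1 : ε * (u / θ) = (1 - ε) * u := by rw [hθ]; field_simp
  have e2 : (1 - ε) ^ 2 + 2 * (1 - ε) * (ε * (u / θ)) + q * (ε * (u / θ)) ^ 2
      = (1 - ε) ^ 2 * (1 + 2 * u + q * u ^ 2) := by rw [e1]; ring
  rw [e2]
  set A := 1 + 2 * u + q * u ^ 2
  have hA : 0 < A := by positivity
  calc _ = 16 * ((n : ℝ) + 1) ^ 2 * (v / θ) ^ 2 * (v ^ 2 / (q * u ^ 2)) ^ m *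
        (A / (1 + v) ^ 2) ^ n *
        ((1 + v) ^ n * θ ^ (m + 1) * (1 - ε) ^ n / (4 * ((n : ℝ) + 1) * v ^ (m + 1))) ^ 2 := by
        clear_value A θ v q
        simp only [mul_pow, div_pow, ← pow_mul, pow_add, mul_comm n 2, mul_comm m 2]
        field_simp
        ring
    _ ≤ _ := by gcongr

theorem rpow_le_add_inv {z s : ℝ} (hz : 0 < z) (hs : |s| < 1) : z ^ s ≤ z + z⁻¹ := by
  obtain ⟨h1, h2⟩ := abs_lt.1 hs
  have hz' : 0 < z⁻¹ := inv_pos.2 hz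
  rcases le_total 1 z with h | h
  · have := Real.rpow_le_rpow_of_exponent_le h h2.le
    rw [Real.rpow_one] at this
    linarith
  · have := Real.rpow_le_rpow_of_exponent_ge hz h h1.le
    rw [Real.rpow_neg_one] at this
    linarith

/-- Rounding `μ n` to `m` costs only a factor independent of `n`, whichever side of `1` the base `z`
lies on. -/
theorem pow_le_rpow_pow {z μ : ℝ} {m n : ℕ} (hz : 0 < z) (hm : |(m : ℝ) - μ * n| < 1) :
    z ^ m ≤ (z + z⁻¹) * (z ^ μ) ^ n := by
  have : z ^ m = z ^ ((m : ℝ) - μ * n) * (z ^ μ) ^ n := by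
    rw [← Real.rpow_natCast (z ^ μ), ← Real.rpow_mul hz.le, ← Real.rpow_add hz, sub_add_cancel,
      Real.rpow_natCast]
  rw [this]
  exact mul_le_mul_of_nonneg_right (rpow_le_add_inv hz hm) (by positivity)

theorem eventually_sq_mul_pow_lt {r : ℝ} (hr0 : 0 < r) (hr1 : r < 1) (K : ℝ) :
    ∀ᶠ n : ℕ in Filter.atTop, K * ((n : ℝ) + 1) ^ 2 * (r ^ 2) ^ n < r ^ n := by
  have h := (tendsto_pow_const_mul_const_pow_of_abs_lt_one 2
    (show |r| < 1 by rwa [abs_of_pos hr0])).const_mul (|K| * 4)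
  rw [mul_zero] at h
  filter_upwards [h.eventually_lt_const one_pos, Filter.eventually_ge_atTop 1] with n hn h1
  have h1' : (1 : ℝ) ≤ n := by exact_mod_cast h1
  have hrn : 0 < r ^ n := by positivity
  have hsq : ((n : ℝ) + 1) ^ 2 ≤ 4 * (n : ℝ) ^ 2 := by nlinarith
  calc K * ((n : ℝ) + 1) ^ 2 * (r ^ 2) ^ n ≤ |K| * (4 * (n : ℝ) ^ 2) * (r ^ 2) ^ n := by
        gcongr; exact le_abs_self K
    _ = |K| * 4 * ((n : ℝ) ^ 2 * r ^ n) * r ^ n := by ring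
    _ < 1 * r ^ n := mul_lt_mul_of_pos_right hn hrn
    _ = r ^ n := one_mul _

theorem theorem3 (F : Type*) [Field F] [Fintype F] (q : ℕ) (hq : Fintype.card F = q)
    (ε R : ℝ) (hε0 : 0 < ε) (hε1 : ε < 1) (hR0 : 0 < R) (hR1 : R < 1)
    (hcond : ((1 - ε) / (1 + ((q : ℝ) - 1) * ε ^ 2) ≤ R ∧ R < 1 - ε) ∨
      ((q = 2 ∨ q = 3 ∨ q = 4) ∧ (1 - ε) / (1 + ((q : ℝ) - 1) * ε) ≤ R ∧ R < 1 - ε)) :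
    ∀ δ : ℝ, 0 < δ → ∃ c : ℝ, 0 < c ∧ ∃ n₀ : ℕ, 0 < n₀ ∧ ∀ n : ℕ, n₀ < n →
      ∀ m : ℕ, |(m : ℝ) - (1 - R) * (n : ℝ)| < 1 →
        ensembleProb (fun H : Matrix (Fin m) (Fin n) F =>
          |pUdMatrix H ε / pUdEnsemble F m n ε - 1| < δ) > 1 - (q : ℝ) ^ (-((n : ℝ) * c)) := by
  intro δ hδ
  subst hq
  have hq1 : (1 : ℝ) < Fintype.card F := by exact_mod_cast Fintype.one_lt_card
  obtain ⟨u, hu0, hu1, hu⟩ := exists_tilt hq1 hε0 hε1 hR0 hR1 (by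
    rcases hcond with h | ⟨h, h', -⟩
    · exact Or.inl h.1
    · refine Or.inr ⟨?_, h'⟩
      rcases h with h | h | h <;> rw [h] <;> norm_num)
  have hR' : 0 < 1 - R := by linarith
  have hε' : 0 < 1 - ε := by linarith
  set q : ℝ := (Fintype.card F : ℝ) with hqdef
  have hq0 : 0 < q := by linarith
  set v := (1 - R) / R with hv
  have hv0 : 0 < v := by positivity
  set z := v ^ 2 / (q * u ^ 2) with hz
  have hz0 : 0 < z := by positivity
  set A := 1 + 2 * u + q * u ^ 2
  have hA : 0 < A := by positivity
  set lam := z ^ (1 - R) * (A / (1 + v) ^ 2) with hlam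
  have hlam0 : 0 < lam := by positivity
  have hlam1 : lam < 1 := by
    rw [hlam, ← mul_div_assoc, div_lt_one (by positivity)]
    exact hu
  -- With `r = √lam`, half of the decay of `lam ^ n` absorbs the polynomial and constant factors;
  -- the other half is `r ^ n = q ^ (-n c)`.
  have hr1 : Real.sqrt lam < 1 := by rw [Real.sqrt_lt' one_pos]; simpa using hlam1
  have hr0 : 0 < Real.sqrt lam := Real.sqrt_pos.2 hlam0
  set r := Real.sqrt lam
  have hr2 : r ^ 2 = lam := Real.sq_sqrt hlam0.le
  have hlogq : 0 < Real.log q := Real.log_pos hq1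
  have hlogr : Real.log r < 0 := Real.log_neg hr0 hr1
  refine ⟨-Real.log r / Real.log q, div_pos (by linarith) hlogq, ?_⟩
  have hqr : ∀ n : ℕ, q ^ (-((n : ℝ) * (-Real.log r / Real.log q))) = r ^ n := by
    intro n
    rw [Real.rpow_def_of_pos hq0, ← Real.rpow_natCast, Real.rpow_def_of_pos hr0]
    congr 1
    field_simp
  set K := 16 * (v / (ε / (1 - ε))) ^ 2 * (z + z⁻¹) / δ ^ 2 with hK
  obtain ⟨n₁, hn₁⟩ := Filter.eventually_atTop.1 ((eventually_sq_mul_pow_lt hr0 hr1 K).and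
    ((tendsto_natCast_atTop_atTop (R := ℝ)).eventually_ge_atTop
      -- The first bound is needed for the binomial estimate; the second gives `R n ≥ 2`, hence `m +
      -- 1 ≤ n`.
      (max ((2 + 2 * v) / (1 - R)) (2 / R))))
  refine ⟨n₁ + 1, Nat.succ_pos _, fun n hn m hm => ?_⟩
  obtain ⟨hKn, hlarge⟩ := hn₁ n (by omega)
  rw [max_le_iff, div_le_iff₀ hR', div_le_iff₀ hR0] at hlarge
  have hmn : m + 1 ≤ n := by
    have := (abs_lt.1 hm).2
    have : (m : ℝ) + 1 ≤ n := by linarith [hlarge.2]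
    exact_mod_cast this
  obtain ⟨hX, hV⟩ := relative_variance_le (F := F) hε0 hε1 hR0 hR1 hu0 hu1 hm
    (by linarith [hlarge.1]) hmn
  refine lt_of_lt_of_le ?_ (prob_relative_deviation_ge hδ hX)
  rw [hqr]
  refine sub_lt_sub_left (lt_of_le_of_lt ?_ hKn) _
  rw [div_le_iff₀ (by positivity), hr2]
  refine hV.trans ?_
  calc _ ≤ 16 * ((n : ℝ) + 1) ^ 2 * (v / (ε / (1 - ε))) ^ 2 *
        ((z + z⁻¹) * (z ^ (1 - R)) ^ n) * (A / (1 + v) ^ 2) ^ n * pUdEnsemble F m n ε ^ 2 := by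
        gcongr
        exact pow_le_rpow_pow hz0 hm
    _ = _ := by
        rw [hK, hlam, mul_pow (z ^ (1 - R))]
        field_simp
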